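/- \textbf{Setting.} Let $\mathcal{D}$ be a probability distribution on a measurable space $\mathcal{Z}$ and let $f:\mathbb{R}^d\times\mathcal{Z}\to[0,1]$ be a loss function, measurable in $z$ for each fixed $w$ and twice differentiable in $w$, such that for all $w,v\in\mathbb{R}^d$ and $z\in\mathcal{Z}$ $$\|\nabla f(w,z)\|\le L,\qquad \|\nabla f(w,z)-\nabla f(v,z)\|\le\beta\|w-v\|,\qquad \|\nabla^2 f(w,z)-\nabla^2 f(v,z)\|_2\le\rho\|w-v\|,$$ with $L,\rho\ge 0$ and $\beta>0$. Put $R(w)=\mathbb{E}_{z\sim\mathcal{D}}[f(w,z)]$, $R^\star=\inf_w R(w)$, and $\widehat R_S(w)=\frac1m\sum_{i=1}^m f(w,z_i)$ for a training set $S=(z_1,\dots,z_m)$ drawn i.i.d. from $\mathcal{D}$. Let $1\le T\le m$, let $j_1,\dots,j_T$ be drawn uniformly from $\{1,\dots,m\}$ without replacement, independently of $S$, and from a fixed $w_1\in\mathbb{R}^d$ run SGD $$w_{t+1}=w_t-\alpha_t\nabla f(w_t,z_{j_t}),\qquad \alpha_t=\frac ct,\qquad t=1,\dots,T,$$ with output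 $A_S=w_{T+1}$; $\mathbb{E}_{S,A}$ is the expectation over $S$ and the indices. Assume that $0<c\le\frac1\beta$ and $c\cdot 4(2\beta\ln T)^2\le 1$, and that for some $\sigma\ge 0$, with $z\sim\mathcal{D}$ independent of $S$ and of the indices, $\mathbb{E}\|\nabla f(w_t,z)-\nabla R(w_t)\|^2\le\sigma^2$ for $t=1,\dots,T$. For any $\kappa>0$ and $p\ge0$ let $$\gamma=\min\Big\{\beta,\ \kappa(1+\ln T)^p\Big(\mathbb{E}_z\|\nabla^2 f(w_1,z)\|_2+\rho\big(c\sigma+\sqrt{c(R(w_1)-R^\star)}\big)\Big)\Big\},$$ and assume $\gamma>0$. \textbf{Claim.} There is a constant $C>0$ that depends only on $c$ and $L$ such that always $$\mathbb{E}_{S,A}\big[R(A_S)-\widehat R_S(A_S)\big]\le C\,\frac{1+\frac1{c\gamma}}{m}\,\max\Big\{\big(\mathbb{E}_{S,A}[\widehat R_S(A_S)]\cdot T\big)^{\frac{c\gamma}{1+c\gamma}},\ \Big(\frac Tm\Big)^{c\gamma}\Big\}.$$ Consequently, with the same $C$ and for every $K\ge 0$: if $\mathbb{E}_{S,A}[\widehat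 R_S(A_S)]\le K\,T^{c\gamma}/m^{1+c\gamma}$, then $$\mathbb{E}_{S,A}\big[R(A_S)-\widehat R_S(A_S)\big]\le C(1+K)\Big(1+\frac1{c\gamma}\Big)\frac{T^{c\gamma}}{m^{1+c\gamma}};$$ and if $\mathbb{E}_{S,A}[\widehat R_S(A_S)]\le K/m$, then $$\mathbb{E}_{S,A}\big[R(A_S)-\widehat R_S(A_S)\big]\le C(1+K)\Big(1+\frac1{c\gamma}\Big)\frac1m,$$ in particular for a full pass $T=m$ with vanishing empirical risk. -/

import Mathlib

open MeasureTheory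

noncomputable section

namespace SGDStability

/-- The parameter space: `ℝ^d` with its Euclidean norm. -/
abbrev Param (d : ℕ) : Type := EuclideanSpace ℝ (Fin d)

variable {d : ℕ} {Z : Type*}

/-- The gradient `∇ f(w, z)` of a loss `f` with respect to the parameter `w`. -/
def grad (f : Param d → Z → ℝ) (w : Param d) (z : Z) : Param d :=
  gradient (fun v => f v z) w

/-- The Hessian `∇² f(w, z)` with respect to `w`, as a continuous linear map; its operator
norm is the spectral norm. -/
def hess (f : Param d → Z → ℝ) (w : Param d) (z : Z) : Param d →L[ℝ] Param d :=
  fderiv ℝ (fun v => grad f v z) w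

/-- `f` is `L`-Lipschitz: it is differentiable in `w` and `‖∇ f(w, z)‖ ≤ L` everywhere. -/
def IsLipschitzLoss (f : Param d → Z → ℝ) (L : ℝ) : Prop :=
  (∀ z, Differentiable ℝ (fun w => f w z)) ∧ ∀ w z, ‖grad f w z‖ ≤ L

/-- `f` is `β`-smooth: it is differentiable in `w` and its gradient is `β`-Lipschitz in `w`. -/
def IsSmoothLoss (f : Param d → Z → ℝ) (β : ℝ) : Prop :=
  (∀ z, Differentiable ℝ (fun w => f w z)) ∧
    ∀ w v z, ‖grad f w z - grad f v z‖ ≤ β * ‖w - v‖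

/-- `f` has a `ρ`-Lipschitz Hessian: it is twice differentiable in `w` and
`‖∇² f(w, z) - ∇² f(v, z)‖₂ ≤ ρ ‖w - v‖`. -/
def HasLipschitzHessian (f : Param d → Z → ℝ) (ρ : ℝ) : Prop :=
  (∀ z, Differentiable ℝ (fun w => f w z)) ∧
  (∀ z, Differentiable ℝ (fun w => grad f w z)) ∧
    ∀ w v z, ‖hess f w z - hess f v z‖ ≤ ρ * ‖w - v‖

/-- The risk `R(w) = E_{z ∼ D} f(w, z)`. -/
def risk [MeasurableSpace Z] (D : Measure Z) (f : Param d → Z → ℝ) (w : Param d) : ℝ :=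
  ∫ z, f w z ∂D

/-- `R⋆ = inf_w R(w)`. -/
def optRisk [MeasurableSpace Z] (D : Measure Z) (f : Param d → Z → ℝ) : ℝ :=
  ⨅ w : Param d, risk D f w

/-- The empirical risk of `w` on the training set `S = (z_1, …, z_m)`. -/
def empRisk {m : ℕ} (f : Param d → Z → ℝ) (S : Fin m → Z) (w : Param d) : ℝ :=
  (∑ i, f w (S i)) / m

/-- SGD with step sizes `α_t = c / t`, run on the training set `S` with the example indices
`j`. The value at `n` is the iterate after the first `n` updates, that is `w_{S,n+1}`:
`w_{S,1} = w₁` and `w_{S,t+1} = w_{S,t} - (c / t) ∇ f(w_{S,t}, z_{j_t})` for `1 ≤ t ≤ T`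
(`j` is indexed from `0`, so `j_t` is the entry of `j` at `t - 1`). -/
def sgdIter {m T : ℕ} (f : Param d → Z → ℝ) (c : ℝ) (w₁ : Param d) (S : Fin m → Z)
    (j : Fin T ↪ Fin m) : ℕ → Param d
  | 0 => w₁
  | n + 1 =>
    if h : n < T then
      sgdIter f c w₁ S j n
        - (c / ((n : ℝ) + 1)) • grad f (sgdIter f c w₁ S j n) (S (j ⟨n, h⟩))
    else sgdIter f c w₁ S j n

/-- The output `A_S` of SGD: the iterate after all `T` updates. -/
def sgdOutput {m T : ℕ} (f : Param d → Z → ℝ) (c : ℝ) (w₁ : Param d) (S : Fin m → Z)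
    (j : Fin T ↪ Fin m) : Param d :=
  sgdIter f c w₁ S j T

/-- The expectation `E_{S,A}`: the training set `S` is drawn i.i.d. from `D`, and the indices
`j_1, …, j_T` are drawn uniformly from `{1, …, m}` without replacement, independently of `S`. -/
def expectSA [MeasurableSpace Z] (D : Measure Z) (m T : ℕ)
    (g : (Fin m → Z) → (Fin T ↪ Fin m) → ℝ) : ℝ :=
  ∫ S, (∑ j, g S j) / (Fintype.card (Fin T ↪ Fin m) : ℝ) ∂Measure.pi (fun _ : Fin m => D)

/-- The variance of the stochastic gradients along the path of SGD is at most `σ²`: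
`E ‖∇ f(w_{S,t}, z) - ∇ R(w_{S,t})‖² ≤ σ²` for `t = 1, …, T`, with `z ∼ D` a fresh example. -/
def HasGradVariance [MeasurableSpace Z] (D : Measure Z) (f : Param d → Z → ℝ) (c : ℝ)
    (w₁ : Param d) (m T : ℕ) (σ : ℝ) : Prop :=
  ∀ n < T,
    expectSA D m T (fun S j =>
      ∫ z, ‖grad f (sgdIter f c w₁ S j n) z
        - gradient (risk D f) (sgdIter f c w₁ S j n)‖ ^ 2 ∂D) ≤ σ ^ 2

/-- `E_{S,A}[R(A_S) - R̂_S(A_S)]`. -/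
def expGap [MeasurableSpace Z] (D : Measure Z) (f : Param d → Z → ℝ) (c : ℝ)
    (w₁ : Param d) (m T : ℕ) : ℝ :=
  expectSA D m T (fun S (j : Fin T ↪ Fin m) =>
    risk D f (sgdOutput f c w₁ S j) - empRisk f S (sgdOutput f c w₁ S j))

/-- `E_{S,A}[R̂_S(A_S)]`. -/
def expEmpRisk [MeasurableSpace Z] (D : Measure Z) (f : Param d → Z → ℝ) (c : ℝ)
    (w₁ : Param d) (m T : ℕ) : ℝ :=
  expectSA D m T (fun S (j : Fin T ↪ Fin m) => empRisk f S (sgdOutput f c w₁ S j))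

/-- `Δ⋆ = ρ (c σ + √(c (R(w₁) - R⋆)))`. -/
def deltaStar [MeasurableSpace Z] (D : Measure Z) (f : Param d → Z → ℝ) (c ρ σ : ℝ)
    (w₁ : Param d) : ℝ :=
  ρ * (c * σ + Real.sqrt (c * (risk D f w₁ - optRisk D f)))

/-- The curvature parameter
`γ = min {β, κ (1 + ln T)^p (E_z ‖∇² f(w₁, z)‖₂ + Δ⋆)}`, where `κ (1 + ln T)^p` is the
factor, polylogarithmic in `T`, that a soft-O leaves unspecified. -/
def sgdGamma [MeasurableSpace Z] (D : Measure Z) (f : Param d → Z → ℝ) (c β ρ σ κ p : ℝ)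
    (w₁ : Param d) (T : ℕ) : ℝ :=
  min β (κ * (1 + Real.log T) ^ p * ((∫ z, ‖hess f w₁ z‖ ∂D) + deltaStar D f c ρ σ w₁))

end SGDStability

end

/-!
The bound follows from a worst-case stability argument with a cut-off time.

*Expansion.* Two runs of SGD on samples that differ in the example used by update `t` separate
at that update by at most `2 c L / t`, and every later update `s` expands the distance by a
factor of at most `1 + c β / s` (`norm_sgdIter_sub_le`). The product of these factors is at most
`exp (c β ln T)`, and the step-size condition `c * 4 (2 β ln T)² ≤ 1` says precisely that
`c β ln T ≤ √c / 4` (`mul_log_le_sqrt`). So the final distance is at most a constant, depending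
only on `c` and `L`, divided by `t`.

*Cut-off.* Fix the order of the examples. Replacing one example by a fresh one preserves the law
of the sample (`measurePreserving_update`), so the generalization gap is `1 / m` times the sum,
over the examples, of the expected change of the loss under such a replacement. As `0 ≤ f`, each
term is at most the risk of the output, that is the gap plus the empirical risk; use this for the
examples of the first `k` updates and stability for those visited later. Examples never visited
contribute nothing (`integral_gap_sgdOutput_le`). With
`∑_{k < t ≤ T} 1 / t ≤ ln (T / k) ≤ (T / k) ^ x / x` this gives, for `g` the gap, `e` the
empirical risk, a constant `B` depending only on `c` and `L`, and every `x > 0`, `1 ≤ k ≤ T`,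
`m g ≤ k (g + e) + (B / x) (T / k) ^ x`.

*Optimization.* Take `x = c γ`, which is at most `c β ≤ 1`. If `g ≤ e`, balancing the two terms
in `k` yields the bound by `(e T) ^ (x / (1 + x))` (`gap_le_of_le_empRisk`). If `e < g`, the
choice `k ≈ m / 4` absorbs the first term into the left-hand side and yields the bound by
`(T / m) ^ x` (`gap_le_of_empRisk_lt`).
-/

/-! ### Regularity and measurability -/

namespace SGDStability

variable {d : ℕ} {Z : Type*}

theorem IsLipschitzLoss.abs_sub_le {f : Param d → Z → ℝ} {L : ℝ} (hf : IsLipschitzLoss f L)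
    (w v : Param d) (z : Z) : |f w z - f v z| ≤ L * ‖w - v‖ := by
  have h := Convex.norm_image_sub_le_of_norm_fderiv_le (𝕜 := ℝ) (f := fun u => f u z) (C := L)
    (s := Set.univ) (x := v) (y := w) (fun u _ => hf.1 z u) (fun u _ => ?_) convex_univ
    trivial trivial
  · simpa [Real.norm_eq_abs] using h
  · have := hf.2 u z
    rwa [grad, gradient, LinearIsometryEquiv.norm_map] at this

theorem measurable_grad [MeasurableSpace Z] {f : Param d → Z → ℝ}
    (hmeas : ∀ w, Measurable (f w)) (hd : ∀ z, Differentiable ℝ (fun w => f w z)) (w : Param d) :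
    Measurable (grad f w) := by
  have key : ∀ i : Fin d, Measurable (fun z => grad f w z i) := by
    intro i
    have hcoord : ∀ z, grad f w z i
        = fderiv ℝ (fun v => f v z) w (EuclideanSpace.single i (1 : ℝ)) := by
      intro z
      rw [← InnerProductSpace.toDual_symm_apply (𝕜 := ℝ), EuclideanSpace.inner_single_right]
      simp [grad, gradient]
    -- A partial derivative is a pointwise limit of difference quotients.
    refine measurable_of_tendsto_metrizable
      (f := fun (n : ℕ) z => (n : ℝ) •
        (f (w + (n : ℝ)⁻¹ • EuclideanSpace.single i (1 : ℝ)) z - f w z)) (fun n => ?_) ?_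
    · exact ((hmeas _).sub (hmeas _)).const_smul (n : ℝ)
    · rw [tendsto_pi_nhds]
      intro z
      rw [hcoord z]
      refine (hd z w).hasFDerivAt.lim (EuclideanSpace.single i (1 : ℝ)) ?_
      simpa using tendsto_natCast_atTop_atTop (R := ℝ)
  have h2 : Measurable (fun z => (WithLp.ofLp (grad f w z) : Fin d → ℝ)) :=
    measurable_pi_iff.2 key
  exact (MeasurableEquiv.toLp 2 (Fin d → ℝ)).measurable.comp h2

/-- The loss is a Carathéodory function, hence jointly measurable. -/
theorem measurable_uncurry_loss [MeasurableSpace Z] {f : Param d → Z → ℝ}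
    (hmeas : ∀ w, Measurable (f w)) (hd : ∀ z, Differentiable ℝ (fun w => f w z)) :
    Measurable (Function.uncurry f) :=
  measurable_uncurry_of_continuous_of_measurable (fun z => (hd z).continuous) hmeas

/-- The gradient is a Carathéodory function, hence jointly measurable. -/
theorem measurable_uncurry_grad [MeasurableSpace Z] {f : Param d → Z → ℝ} {β : ℝ}
    (hmeas : ∀ w, Measurable (f w)) (hs : IsSmoothLoss f β) :
    Measurable (Function.uncurry (grad f)) := by
  have hc : ∀ z, Continuous (fun w => grad f w z) := fun z =>
    (LipschitzWith.of_dist_le' (K := β) fun w v => by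
      simpa [dist_eq_norm] using hs.2 w v z).continuous
  exact measurable_uncurry_of_continuous_of_measurable hc (measurable_grad hmeas hs.1)

theorem measurable_sgdIter [MeasurableSpace Z] {f : Param d → Z → ℝ} {β : ℝ}
    (hmeas : ∀ w, Measurable (f w)) (hs : IsSmoothLoss f β) (c : ℝ) (w₁ : Param d) {m T : ℕ}
    (j : Fin T ↪ Fin m) (n : ℕ) : Measurable (fun S => sgdIter f c w₁ S j n) := by
  induction n with
  | zero => exact measurable_const
  | succ n ih =>
    by_cases h : n < T
    · simp only [sgdIter, h, dite_true]
      have hg : Measurable fun S : Fin m → Z =>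
          grad f (sgdIter f c w₁ S j n) (S (j ⟨n, h⟩)) :=
        (measurable_uncurry_grad hmeas hs).comp (ih.prodMk (measurable_pi_apply _))
      exact ih.sub (hg.const_smul (c / ((n : ℝ) + 1)))
    · simpa only [sgdIter, h, dite_false] using ih

theorem measurable_sgdOutput [MeasurableSpace Z] {f : Param d → Z → ℝ} {β : ℝ}
    (hmeas : ∀ w, Measurable (f w)) (hs : IsSmoothLoss f β) (c : ℝ) (w₁ : Param d) {m T : ℕ}
    (j : Fin T ↪ Fin m) : Measurable (fun S => sgdOutput f c w₁ S j) :=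
  measurable_sgdIter hmeas hs c w₁ j T

/-! ### Sensitivity of SGD to a single example -/

theorem sgdIter_congr {f : Param d → Z → ℝ} {c : ℝ} {w₁ : Param d} {m T : ℕ}
    {S S' : Fin m → Z} {j : Fin T ↪ Fin m} {n : ℕ}
    (h : ∀ s : Fin T, (s : ℕ) < n → S (j s) = S' (j s)) :
    sgdIter f c w₁ S j n = sgdIter f c w₁ S' j n := by
  induction n with
  | zero => rfl
  | succ n ih =>
    have ih' := ih fun s hs => h s (by omega)
    by_cases hn : n < T
    · simp only [sgdIter, hn, dite_true, ih', h ⟨n, hn⟩ (Nat.lt_succ_self n)]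
    · simpa only [sgdIter, hn, dite_false] using ih'

theorem inv_succ_le_log_sub_log {n : ℕ} (hn : 1 ≤ n) :
    1 / ((n : ℝ) + 1) ≤ Real.log ((n : ℝ) + 1) - Real.log n := by
  have hn' : (0 : ℝ) < n := by exact_mod_cast hn
  rw [← Real.log_div (by positivity) hn'.ne']
  refine le_trans (le_of_eq ?_) (Real.one_sub_inv_le_log_of_pos (by positivity))
  field_simp
  ring

/-- Two runs of SGD whose data differ only at the example used in the update number `t + 1`
split at that update by at most `2 c L / (t + 1)`, and each later update expands the distance
by a factor of at most `1 + c β / (n + 1)`. -/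
theorem norm_sgdIter_sub_le {f : Param d → Z → ℝ} {c L β : ℝ} (hc : 0 ≤ c)
    (hβ : 0 ≤ β) (hf : IsLipschitzLoss f L) (hs : IsSmoothLoss f β) {w₁ : Param d} {m T : ℕ}
    {S S' : Fin m → Z} {j : Fin T ↪ Fin m} {t : Fin T} (hL : 0 ≤ L)
    (h : ∀ s, s ≠ t → S (j s) = S' (j s)) {n : ℕ} (htn : (t : ℕ) + 1 ≤ n) (hnT : n ≤ T) :
    ‖sgdIter f c w₁ S j n - sgdIter f c w₁ S' j n‖
      ≤ 2 * c * L / ((t : ℝ) + 1) * Real.exp (c * β * Real.log n) := by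
  induction n, htn using Nat.le_induction with
  | base =>
    have heq : sgdIter f c w₁ S j t = sgdIter f c w₁ S' j t :=
      sgdIter_congr fun s hs => h s (by rintro rfl; omega)
    have hexp : 1 ≤ Real.exp (c * β * Real.log ((t : ℕ) + 1 : ℕ)) :=
      Real.one_le_exp (mul_nonneg (mul_nonneg hc hβ) (Real.log_natCast_nonneg _))
    simp only [sgdIter, t.isLt, dite_true, heq]
    rw [sub_sub_sub_cancel_left, ← smul_sub, norm_smul, Real.norm_of_nonneg (by positivity)]
    have hg := (norm_sub_le (grad f (sgdIter f c w₁ S' j t) (S' (j t)))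
      (grad f (sgdIter f c w₁ S' j t) (S (j t)))).trans (add_le_add (hf.2 _ _) (hf.2 _ _))
    calc c / ((t : ℝ) + 1) * _ ≤ c / ((t : ℝ) + 1) * (L + L) := by gcongr
      _ = 2 * c * L / ((t : ℝ) + 1) * 1 := by ring
      _ ≤ _ := by gcongr
  | succ n htn ih =>
    have ih' := ih (by omega)
    have hn : n < T := by omega
    have hdata : S (j ⟨n, hn⟩) = S' (j ⟨n, hn⟩) :=
      h _ (by rintro rfl; simp at htn)
    simp only [sgdIter, hn, dite_true, hdata]
    set u := sgdIter f c w₁ S j n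
    set v := sgdIter f c w₁ S' j n
    set z := S' (j ⟨n, hn⟩)
    have hstep : u - (c / ((n : ℝ) + 1)) • grad f u z - (v - (c / ((n : ℝ) + 1)) • grad f v z)
        = (u - v) - (c / ((n : ℝ) + 1)) • (grad f u z - grad f v z) := by
      rw [smul_sub]; abel
    have hlog := inv_succ_le_log_sub_log (n := n) (by omega)
    rw [hstep]
    calc ‖(u - v) - (c / ((n : ℝ) + 1)) • (grad f u z - grad f v z)‖
        ≤ ‖u - v‖ + c / ((n : ℝ) + 1) * (β * ‖u - v‖) := by
          refine (norm_sub_le _ _).trans ?_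
          rw [norm_smul, Real.norm_of_nonneg (by positivity)]
          gcongr
          exact hs.2 u v z
      _ = (c * β * (1 / ((n : ℝ) + 1)) + 1) * ‖u - v‖ := by ring
      _ ≤ Real.exp (c * β * (Real.log ((n : ℝ) + 1) - Real.log n)) *
          (2 * c * L / ((t : ℝ) + 1) * Real.exp (c * β * Real.log n)) := by
          gcongr
          exact (Real.add_one_le_exp _).trans (Real.exp_le_exp.2 (by gcongr))
      _ = 2 * c * L / ((t : ℝ) + 1) * (Real.exp
          (c * β * (Real.log ((n : ℝ) + 1) - Real.log n)) * Real.exp (c * β * Real.log n)) := by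
          ring
      _ = _ := by
          rw [← Real.exp_add]
          push_cast
          congr 2
          ring

theorem abs_loss_sgdOutput_sub_le {f : Param d → Z → ℝ} {c L β : ℝ} (hc : 0 ≤ c) (hL : 0 ≤ L)
    (hβ : 0 ≤ β) (hf : IsLipschitzLoss f L) (hs : IsSmoothLoss f β) {w₁ : Param d} {m T : ℕ}
    {S S' : Fin m → Z} {j : Fin T ↪ Fin m} {t : Fin T}
    (h : ∀ s, s ≠ t → S (j s) = S' (j s)) (z : Z) :
    |f (sgdOutput f c w₁ S j) z - f (sgdOutput f c w₁ S' j) z|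
      ≤ 2 * c * L ^ 2 * Real.exp (c * β * Real.log T) * (1 / ((t : ℝ) + 1)) := by
  refine (hf.abs_sub_le _ _ z).trans ?_
  have := norm_sgdIter_sub_le (w₁ := w₁) hc hβ hf hs hL h t.isLt le_rfl
  calc L * _ ≤ L * _ := mul_le_mul_of_nonneg_left this hL
    _ = _ := by ring

/-! ### Exchanging an example for a fresh one -/

/-- Replacing one entry of an i.i.d. sample by a fresh draw does not change its law. -/
theorem measurePreserving_update [MeasurableSpace Z] (D : Measure Z) [IsProbabilityMeasure D]
    {m : ℕ} (i : Fin m) :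
    MeasurePreserving (fun p : (Fin m → Z) × Z => Function.update p.1 i p.2)
      ((Measure.pi fun _ : Fin m => D).prod D) (Measure.pi fun _ : Fin m => D) := by
  have hm : Measurable (fun p : (Fin m → Z) × Z => Function.update p.1 i p.2) := by
    rw [measurable_pi_iff]
    intro k
    rcases eq_or_ne k i with rfl | hk
    · simpa using measurable_snd
    · simp only [Function.update_of_ne hk]
      exact (measurable_pi_apply k).comp measurable_fst
  refine ⟨hm, (Measure.pi_eq fun s hs => ?_).symm⟩
  have hpre : (fun p : (Fin m → Z) × Z => Function.update p.1 i p.2) ⁻¹' Set.univ.pi s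
      = (Set.univ.pi (Function.update s i Set.univ)) ×ˢ s i := by
    ext p
    simp only [Set.mem_preimage, Set.mem_pi, Set.mem_univ, true_implies, Set.mem_prod]
    constructor
    · intro h
      refine ⟨fun k => ?_, by simpa using h i⟩
      rcases eq_or_ne k i with rfl | hk
      · simp
      · simpa [Function.update_of_ne hk] using h k
    · rintro ⟨h, hi⟩ k
      rcases eq_or_ne k i with rfl | hk
      · simpa using hi
      · simpa [Function.update_of_ne hk] using h k
  rw [Measure.map_apply hm (MeasurableSet.univ_pi hs), hpre, Measure.prod_prod, Measure.pi_pi,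
    ← Finset.mul_prod_erase Finset.univ (fun k => D (s k)) (Finset.mem_univ i),
    ← Finset.mul_prod_erase Finset.univ (fun k => D (Function.update s i Set.univ k))
      (Finset.mem_univ i)]
  have : ∏ k ∈ Finset.univ.erase i, D (Function.update s i Set.univ k)
      = ∏ k ∈ Finset.univ.erase i, D (s k) :=
    Finset.prod_congr rfl fun k hk => by rw [Function.update_of_ne (Finset.ne_of_mem_erase hk)]
  simp [this, mul_comm]

theorem integrable_of_mem_Icc {Ω : Type*} [MeasurableSpace Ω] {μ : Measure Ω}
    [IsFiniteMeasure μ] {g : Ω → ℝ} (hg : Measurable g) (h : ∀ x, g x ∈ Set.Icc (0 : ℝ) 1) :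
    Integrable g μ :=
  Integrable.of_bound hg.aestronglyMeasurable 1
    (Filter.Eventually.of_forall fun x => by
      rw [Real.norm_of_nonneg (h x).1]; exact (h x).2)

theorem integral_mem_Icc {Ω : Type*} [MeasurableSpace Ω] {μ : Measure Ω}
    [IsProbabilityMeasure μ] {g : Ω → ℝ} (hg : Measurable g)
    (h : ∀ x, g x ∈ Set.Icc (0 : ℝ) 1) : ∫ x, g x ∂μ ∈ Set.Icc (0 : ℝ) 1 := by
  refine ⟨integral_nonneg fun x => (h x).1, ?_⟩
  simpa using integral_mono (integrable_of_mem_Icc (μ := μ) hg h) (integrable_const 1)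
    fun x => (h x).2

section Learner

variable [MeasurableSpace Z] {D : Measure Z} [IsProbabilityMeasure D] {f : Param d → Z → ℝ}
  {m : ℕ} {A : (Fin m → Z) → Param d}

theorem integrable_risk_comp (hF : Measurable (Function.uncurry f))
    (h01 : ∀ w z, f w z ∈ Set.Icc (0 : ℝ) 1) (hA : Measurable A) :
    Integrable (fun S => risk D f (A S)) (Measure.pi fun _ : Fin m => D) := by
  have hR : Measurable (risk D f) := hF.stronglyMeasurable.integral_prod_right.measurable
  exact integrable_of_mem_Icc (hR.comp hA)
    fun S => integral_mem_Icc (hF.comp measurable_prodMk_left) (h01 _)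

theorem integrable_loss_comp (hF : Measurable (Function.uncurry f))
    (h01 : ∀ w z, f w z ∈ Set.Icc (0 : ℝ) 1) (hA : Measurable A) (i : Fin m) :
    Integrable (fun S => f (A S) (S i)) (Measure.pi fun _ : Fin m => D) :=
  integrable_of_mem_Icc (hF.comp (hA.prodMk (measurable_pi_apply i))) fun _ => h01 _ _

theorem integrable_empRisk_comp (hF : Measurable (Function.uncurry f))
    (h01 : ∀ w z, f w z ∈ Set.Icc (0 : ℝ) 1) (hA : Measurable A) :
    Integrable (fun S => empRisk f S (A S)) (Measure.pi fun _ : Fin m => D) :=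
  (integrable_finsetSum _ fun i _ => integrable_loss_comp hF h01 hA i).div_const _

theorem integrable_gap_comp (hF : Measurable (Function.uncurry f))
    (h01 : ∀ w z, f w z ∈ Set.Icc (0 : ℝ) 1) (hA : Measurable A) :
    Integrable (fun S => risk D f (A S) - empRisk f S (A S)) (Measure.pi fun _ : Fin m => D) :=
  (integrable_risk_comp hF h01 hA).sub (integrable_empRisk_comp hF h01 hA)

/-- By exchangeability, the expected gap between the risk and the loss on the `i`-th example
is the expected change of the loss at a fresh example when that example replaces the `i`-th
one in the training set. -/
theorem integral_risk_sub_loss (hF : Measurable (Function.uncurry f))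
    (h01 : ∀ w z, f w z ∈ Set.Icc (0 : ℝ) 1) (hA : Measurable A) (i : Fin m) :
    ∫ S, (risk D f (A S) - f (A S) (S i)) ∂Measure.pi (fun _ : Fin m => D)
      = ∫ p, (f (A p.1) p.2 - f (A (Function.update p.1 i p.2)) p.2)
          ∂((Measure.pi fun _ : Fin m => D).prod D) := by
  have hmp := measurePreserving_update D i
  have h1 : Measurable fun p : (Fin m → Z) × Z => f (A p.1) p.2 :=
    hF.comp ((hA.comp measurable_fst).prodMk measurable_snd)
  have h2 : Measurable fun p : (Fin m → Z) × Z => f (A (Function.update p.1 i p.2)) p.2 :=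
    hF.comp ((hA.comp hmp.measurable).prodMk measurable_snd)
  have h3 : Measurable fun S : Fin m → Z => f (A S) (S i) :=
    hF.comp (hA.prodMk (measurable_pi_apply i))
  rw [integral_sub (integrable_risk_comp hF h01 hA) (integrable_loss_comp hF h01 hA i),
    integral_sub (integrable_of_mem_Icc h1 fun _ => h01 _ _)
      (integrable_of_mem_Icc h2 fun _ => h01 _ _),
    integral_prod _ (integrable_of_mem_Icc h1 fun _ => h01 _ _)]
  congr 1
  have h4 := integral_map (μ := (Measure.pi fun _ : Fin m => D).prod D)
    hmp.measurable.aemeasurable h3.aestronglyMeasurable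
  rw [hmp.map_eq] at h4
  simpa using h4

theorem integral_gap_eq_sum (hF : Measurable (Function.uncurry f))
    (h01 : ∀ w z, f w z ∈ Set.Icc (0 : ℝ) 1) (hA : Measurable A) (hm : 0 < m) :
    ∫ S, (risk D f (A S) - empRisk f S (A S)) ∂Measure.pi (fun _ : Fin m => D)
      = (∑ i, ∫ S, (risk D f (A S) - f (A S) (S i)) ∂Measure.pi (fun _ : Fin m => D)) / m := by
  have hm' : (m : ℝ) ≠ 0 := by positivity
  have hint : ∀ i : Fin m, Integrable (fun S => risk D f (A S) - f (A S) (S i))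
      (Measure.pi fun _ : Fin m => D) := fun i =>
    (integrable_risk_comp hF h01 hA).sub (integrable_loss_comp hF h01 hA i)
  rw [← integral_finsetSum _ fun i _ => hint i, ← integral_div]
  refine integral_congr_ae (Filter.Eventually.of_forall fun S => ?_)
  simp only [empRisk, Finset.sum_sub_distrib, Finset.sum_const, Finset.card_univ,
    Fintype.card_fin, nsmul_eq_mul]
  field_simp

end Learner

/-! ### The generalization gap of SGD -/

/-- For a fixed order of the examples, an example visited in one of the first `k` updates
contributes at most the risk of the output to the gap, an example visited later contributes at
most its influence on the output, and an example never visited contributes nothing. -/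
theorem integral_gap_sgdOutput_le [MeasurableSpace Z] {D : Measure Z} [IsProbabilityMeasure D]
    {f : Param d → Z → ℝ} {c L β : ℝ} (hc : 0 ≤ c) (hL : 0 ≤ L) (hβ : 0 ≤ β)
    (hmeas : ∀ w, Measurable (f w)) (h01 : ∀ w z, f w z ∈ Set.Icc (0 : ℝ) 1)
    (hf : IsLipschitzLoss f L) (hs : IsSmoothLoss f β) {w₁ : Param d} {m T : ℕ} (hm : 0 < m)
    (j : Fin T ↪ Fin m) {k : ℕ} (hk : k ≤ T) :
    ∫ S, (risk D f (sgdOutput f c w₁ S j) - empRisk f S (sgdOutput f c w₁ S j))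
        ∂Measure.pi (fun _ : Fin m => D)
      ≤ (k * ∫ S, risk D f (sgdOutput f c w₁ S j) ∂Measure.pi (fun _ : Fin m => D)
          + 2 * c * L ^ 2 * Real.exp (c * β * Real.log T)
            * ∑ n ∈ Finset.Ico k T, 1 / ((n : ℝ) + 1)) / m := by
  have hF := measurable_uncurry_loss hmeas hs.1
  have hA : Measurable fun S => sgdOutput f c w₁ S j := measurable_sgdOutput hmeas hs c w₁ j
  rw [integral_gap_eq_sum hF h01 hA hm]
  gcongr
  set G : Fin m → ℝ := fun i => ∫ S, (risk D f (sgdOutput f c w₁ S j)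
    - f (sgdOutput f c w₁ S j) (S i)) ∂Measure.pi (fun _ : Fin m => D) with hG
  set r := ∫ S, risk D f (sgdOutput f c w₁ S j) ∂Measure.pi (fun _ : Fin m => D)
  set B := 2 * c * L ^ 2 * Real.exp (c * β * Real.log T)
  have hupd : ∀ (i : Fin m) (S : Fin m → Z) (z : Z) (s : Fin T), j s ≠ i →
      S (j s) = Function.update S i z (j s) := fun i S z s h => by
    rw [Function.update_of_ne h]
  have hunused : ∀ i, i ∉ Set.range j → G i = 0 := by
    intro i hi
    simp only [hG]
    rw [integral_risk_sub_loss hF h01 hA i]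
    refine integral_eq_zero_of_ae (Filter.Eventually.of_forall fun p => ?_)
    have : sgdOutput f c w₁ p.1 j = sgdOutput f c w₁ (Function.update p.1 i p.2) j :=
      sgdIter_congr fun s _ => hupd i _ _ s fun h => hi ⟨s, h⟩
    simp [← this]
  have hrisk : ∀ i, G i ≤ r := fun i =>
    integral_mono ((integrable_risk_comp hF h01 hA).sub (integrable_loss_comp hF h01 hA i))
      (integrable_risk_comp hF h01 hA) fun S => sub_le_self _ (h01 _ _).1
  have hstab : ∀ t : Fin T, G (j t) ≤ B * (1 / ((t : ℝ) + 1)) := by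
    intro t
    simp only [hG]
    rw [integral_risk_sub_loss hF h01 hA (j t)]
    refine (le_abs_self _).trans ?_
    have := norm_integral_le_of_norm_le_const (μ := (Measure.pi fun _ : Fin m => D).prod D)
      (f := fun p => f (sgdOutput f c w₁ p.1 j) p.2
        - f (sgdOutput f c w₁ (Function.update p.1 (j t) p.2) j) p.2)
      (Filter.Eventually.of_forall fun p => abs_loss_sgdOutput_sub_le (w₁ := w₁) hc hL hβ hf hs
        (fun s hst => hupd (j t) p.1 p.2 s (j.injective.ne hst)) p.2)
    simpa using this
  have hsum : ∑ i, G i = ∑ t : Fin T, G (j t) := by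
    rw [← Finset.sum_map Finset.univ j G]
    refine (Finset.sum_subset (Finset.subset_univ _) fun i _ hi => hunused i ?_).symm
    simpa using hi
  calc ∑ i, G i = ∑ t : Fin T, G (j t) := hsum
    _ ≤ ∑ t : Fin T, if (t : ℕ) < k then r else B * (1 / ((t : ℝ) + 1)) := by
        refine Finset.sum_le_sum fun t _ => ?_
        split_ifs
        · exact hrisk _
        · exact hstab t
    _ = ∑ n ∈ Finset.range T, if n < k then r else B * (1 / ((n : ℝ) + 1)) :=
        Fin.sum_univ_eq_sum_range (fun n => if n < k then r else B * (1 / ((n : ℝ) + 1))) T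
    _ = k * r + B * ∑ n ∈ Finset.Ico k T, 1 / ((n : ℝ) + 1) := by
        rw [← Finset.sum_range_add_sum_Ico _ hk, Finset.mul_sum]
        congr 1
        · rw [Finset.sum_congr rfl fun n hn => if_pos (Finset.mem_range.1 hn)]
          simp
        · exact Finset.sum_congr rfl fun n hn =>
            if_neg (not_lt.2 (Finset.mem_Ico.1 hn).1)

theorem expectSA_eq_sum [MeasurableSpace Z] {D : Measure Z} {m T : ℕ}
    {g : (Fin m → Z) → (Fin T ↪ Fin m) → ℝ}
    (hg : ∀ j, Integrable (fun S => g S j) (Measure.pi fun _ : Fin m => D)) :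
    expectSA D m T g = (∑ j, ∫ S, g S j ∂Measure.pi (fun _ : Fin m => D))
      / (Fintype.card (Fin T ↪ Fin m) : ℝ) := by
  rw [expectSA, integral_div, integral_finsetSum _ fun j _ => hg j]

/-- The mean of values in `[0, 1]` lies in `[0, 1]`. -/
theorem sum_div_card_mem_Icc {ι : Type*} [Fintype ι] {a : ι → ℝ}
    (ha : ∀ i, a i ∈ Set.Icc (0 : ℝ) 1) :
    (∑ i, a i) / (Fintype.card ι : ℝ) ∈ Set.Icc (0 : ℝ) 1 := by
  refine ⟨div_nonneg (Finset.sum_nonneg fun i _ => (ha i).1) (Nat.cast_nonneg _),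
    div_le_one_of_le₀ ?_ (Nat.cast_nonneg _)⟩
  simpa using Finset.sum_le_sum fun i (_ : i ∈ Finset.univ) => (ha i).2

theorem empRisk_mem_Icc {f : Param d → Z → ℝ} (h01 : ∀ w z, f w z ∈ Set.Icc (0 : ℝ) 1)
    {m : ℕ} (S : Fin m → Z) (w : Param d) : empRisk f S w ∈ Set.Icc (0 : ℝ) 1 := by
  simpa [empRisk] using sum_div_card_mem_Icc fun i => h01 w (S i)

section Average

variable [MeasurableSpace Z] {D : Measure Z} [IsProbabilityMeasure D] {f : Param d → Z → ℝ}
  {c L β : ℝ} {w₁ : Param d} {m T : ℕ}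

theorem expEmpRisk_mem_Icc (hmeas : ∀ w, Measurable (f w))
    (h01 : ∀ w z, f w z ∈ Set.Icc (0 : ℝ) 1) (hs : IsSmoothLoss f β) :
    expEmpRisk D f c w₁ m T ∈ Set.Icc (0 : ℝ) 1 := by
  have hF := measurable_uncurry_loss hmeas hs.1
  have hA := fun j : Fin T ↪ Fin m => measurable_sgdOutput hmeas hs c w₁ j
  rw [expEmpRisk, expectSA_eq_sum fun j => integrable_empRisk_comp hF h01 (hA j)]
  refine sum_div_card_mem_Icc fun j => ⟨integral_nonneg fun S => (empRisk_mem_Icc h01 _ _).1, ?_⟩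
  simpa using integral_mono (integrable_empRisk_comp (D := D) hF h01 (hA j))
    (integrable_const 1) fun S => (empRisk_mem_Icc h01 _ _).2

theorem expGap_add_expEmpRisk (hmeas : ∀ w, Measurable (f w))
    (h01 : ∀ w z, f w z ∈ Set.Icc (0 : ℝ) 1) (hs : IsSmoothLoss f β) :
    expGap D f c w₁ m T + expEmpRisk D f c w₁ m T
      = (∑ j : Fin T ↪ Fin m, ∫ S, risk D f (sgdOutput f c w₁ S j)
          ∂Measure.pi (fun _ : Fin m => D)) / (Fintype.card (Fin T ↪ Fin m) : ℝ) := by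
  have hF := measurable_uncurry_loss hmeas hs.1
  have hA := fun j : Fin T ↪ Fin m => measurable_sgdOutput hmeas hs c w₁ j
  have hr := fun j => integrable_risk_comp (D := D) hF h01 (hA j)
  have he := fun j => integrable_empRisk_comp (D := D) hF h01 (hA j)
  rw [expGap, expEmpRisk, expectSA_eq_sum he, expectSA_eq_sum fun j => integrable_gap_comp (D := D) hF h01 (hA j),
    ← add_div, ← Finset.sum_add_distrib]
  congr 1
  refine Finset.sum_congr rfl fun j _ => ?_
  exact (congrArg₂ (· + ·) (integral_sub (hr j) (he j)) rfl).trans (sub_add_cancel _ _)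

theorem expGap_le_one (hmeas : ∀ w, Measurable (f w))
    (h01 : ∀ w z, f w z ∈ Set.Icc (0 : ℝ) 1) (hs : IsSmoothLoss f β) :
    expGap D f c w₁ m T ≤ 1 := by
  have hF := measurable_uncurry_loss hmeas hs.1
  have hA := fun j : Fin T ↪ Fin m => measurable_sgdOutput hmeas hs c w₁ j
  have h1 := expGap_add_expEmpRisk (D := D) (c := c) (w₁ := w₁) (m := m) (T := T) hmeas h01 hs
  have h2 := (expEmpRisk_mem_Icc (D := D) (c := c) (w₁ := w₁) (m := m) (T := T) hmeas h01 hs).1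
  have hR : ∀ w, risk D f w ∈ Set.Icc (0 : ℝ) 1 := fun w => integral_mem_Icc (hmeas w) (h01 w)
  have h3 := (sum_div_card_mem_Icc (a := fun j : Fin T ↪ Fin m =>
    ∫ S, risk D f (sgdOutput f c w₁ S j) ∂Measure.pi (fun _ : Fin m => D))
    fun j => ⟨integral_nonneg fun S => (hR _).1, by
      simpa using integral_mono (integrable_risk_comp (D := D) hF h01 (hA j))
        (integrable_const 1) fun S => (hR _).2⟩).2
  linarith

/-- The gap is bounded in terms of itself, with a free cut-off `k` between the early and the
late updates. -/
theorem expGap_le (hc : 0 ≤ c) (hL : 0 ≤ L) (hβ : 0 ≤ β) (hmeas : ∀ w, Measurable (f w))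
    (h01 : ∀ w z, f w z ∈ Set.Icc (0 : ℝ) 1) (hf : IsLipschitzLoss f L) (hs : IsSmoothLoss f β)
    (hT : 1 ≤ T) (hTm : T ≤ m) {k : ℕ} (hk : k ≤ T) :
    expGap D f c w₁ m T ≤ (k * (expGap D f c w₁ m T + expEmpRisk D f c w₁ m T)
      + 2 * c * L ^ 2 * Real.exp (c * β * Real.log T)
        * ∑ n ∈ Finset.Ico k T, 1 / ((n : ℝ) + 1)) / m := by
  have hF := measurable_uncurry_loss hmeas hs.1
  have hA := fun j : Fin T ↪ Fin m => measurable_sgdOutput hmeas hs c w₁ j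
  have : Nonempty (Fin T ↪ Fin m) := ⟨Fin.castLEEmb hTm⟩
  have hN : (0 : ℝ) < Fintype.card (Fin T ↪ Fin m) := by exact_mod_cast Fintype.card_pos
  rw [expGap_add_expEmpRisk hmeas h01 hs]
  nth_rw 1 [expGap]
  rw [expectSA_eq_sum fun j => integrable_gap_comp (D := D) hF h01 (hA j), div_le_iff₀ hN]
  refine (Finset.sum_le_sum fun j _ => integral_gap_sgdOutput_le hc hL hβ hmeas h01 hf hs
    (by omega) j hk).trans (le_of_eq ?_)
  rw [← Finset.sum_div, Finset.sum_add_distrib, ← Finset.mul_sum, Finset.sum_const,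
    Finset.card_univ, nsmul_eq_mul]
  field_simp

end Average

/-! ### Choosing the cut-off -/

theorem sum_Ico_inv_succ_le_log {k T : ℕ} (hk : 1 ≤ k) (hkT : k ≤ T) :
    ∑ n ∈ Finset.Ico k T, 1 / ((n : ℝ) + 1) ≤ Real.log ((T : ℝ) / k) := by
  have hk' : (k : ℝ) ≠ 0 := by exact_mod_cast (by omega : k ≠ 0)
  have hT' : (T : ℝ) ≠ 0 := by exact_mod_cast (by omega : T ≠ 0)
  rw [Real.log_div hT' hk', ← Finset.sum_Ico_sub (fun n : ℕ => Real.log n) hkT]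
  refine Finset.sum_le_sum fun n hn => ?_
  simpa using inv_succ_le_log_sub_log (hk.trans (Finset.mem_Ico.1 hn).1)

theorem sum_Ico_inv_succ_le_rpow {k T : ℕ} (hk : 1 ≤ k) (hkT : k ≤ T) {x : ℝ} (hx : 0 < x) :
    ∑ n ∈ Finset.Ico k T, 1 / ((n : ℝ) + 1) ≤ ((T : ℝ) / k) ^ x / x :=
  (sum_Ico_inv_succ_le_log hk hkT).trans (Real.log_le_rpow_div (by positivity) hx)

/-- When the empirical risk `e` dominates the gap `g`, the cut-off balances
`k * e` against `(T / k) ^ x`, that is `k ≈ (T ^ x / e) ^ (1 / (1 + x))`. -/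
theorem gap_le_of_le_empRisk {B x e g : ℝ} {m T : ℕ} (hB : 0 ≤ B) (hT : 1 ≤ T) (hm : 0 < m)
    (hx : 0 < x) (hx1 : x ≤ 1) (he : 0 < e) (he1 : e ≤ 1) (hge : g ≤ e)
    (hfull : g ≤ T * (g + e) / m)
    (h : ∀ k : ℕ, 1 ≤ k → k ≤ T → g ≤ (k * (g + e) + B * (((T : ℝ) / k) ^ x / x)) / m) :
    g ≤ (2 + 2 * B) * ((1 + 1 / x) / m * (e * T) ^ (x / (1 + x))) := by
  have hm' : (0 : ℝ) < m := by exact_mod_cast hm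
  have hT' : (1 : ℝ) ≤ T := by exact_mod_cast hT
  have hT0 : (0 : ℝ) < T := by linarith
  have h1x : 0 < 1 + x := by linarith
  set q := x / (1 + x) with hq
  have hq0 : 0 < q := by positivity
  have hq1 : q ≤ 1 := (div_le_one h1x).2 (by linarith)
  set Q := (e * T) ^ q with hQ
  have hQ0 : 0 < Q := by positivity
  -- It suffices to bound `m * g` by a multiple of `Q`.
  suffices hmain : m * g ≤ (2 + 2 * B * (1 / x)) * Q by
    have hle : (2 + 2 * B * (1 / x)) * Q ≤ (2 + 2 * B) * (1 + 1 / x) * Q := by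
      gcongr
      have : 0 < 1 / x := by positivity
      nlinarith
    calc g = m * g / m := by field_simp
      _ ≤ (2 + 2 * B) * (1 + 1 / x) * Q / m :=
          div_le_div_of_nonneg_right (hmain.trans hle) hm'.le
      _ = _ := by ring
  set τ := ((T : ℝ) ^ x / e) ^ (1 / (1 + x)) with hτ
  have hτ0 : 0 < τ := by positivity
  have hτpow : τ ^ (1 + x) = (T : ℝ) ^ x / e := by
    rw [hτ, ← Real.rpow_mul (by positivity), one_div_mul_cancel h1x.ne', Real.rpow_one]
  have hτ1 : 1 ≤ τ := Real.one_le_rpow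
    ((one_le_div he).2 (he1.trans (Real.one_le_rpow hT' hx.le))) (by positivity)
  have hτe : τ * e = Q := by
    have hexp : 1 - 1 / (1 + x) = q := by rw [hq]; field_simp; ring
    rw [hτ, Real.div_rpow (by positivity) he.le, ← Real.rpow_mul hT0.le, hQ,
      Real.mul_rpow he.le hT0.le, ← hexp, Real.rpow_sub he, Real.rpow_one, hexp, hq, mul_one_div]
    ring
  have hτQ : ((T : ℝ) / τ) ^ x = Q := by
    rw [← hτe, Real.div_rpow hT0.le hτ0.le, div_eq_iff (by positivity)]
    rw [Real.rpow_add hτ0, Real.rpow_one] at hτpow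
    rw [eq_div_iff he.ne'] at hτpow
    linarith
  have hrest : 0 ≤ 2 * B * (1 / x) * Q := by positivity
  rcases le_total (T : ℝ) τ with hTτ | hτT
  · rw [le_div_iff₀ hm'] at hfull
    have : (T : ℝ) * e ≤ Q := hτe ▸ mul_le_mul_of_nonneg_right hTτ he.le
    nlinarith
  · have hk1 : 1 ≤ ⌊τ⌋₊ := Nat.le_floor (by simpa using hτ1)
    have hkτ : (⌊τ⌋₊ : ℝ) ≤ τ := Nat.floor_le hτ0.le
    have hkT : ⌊τ⌋₊ ≤ T := by exact_mod_cast hkτ.trans hτT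
    have hk1' : (1 : ℝ) ≤ ⌊τ⌋₊ := by exact_mod_cast hk1
    have hτk : τ ≤ 2 * ⌊τ⌋₊ := by linarith [Nat.lt_floor_add_one τ]
    have hpow : ((T : ℝ) / ⌊τ⌋₊) ^ x ≤ 2 * Q := by
      calc ((T : ℝ) / ⌊τ⌋₊) ^ x ≤ (2 * (T / τ)) ^ x := by
            refine Real.rpow_le_rpow (by positivity) ?_ hx.le
            rw [← mul_div_assoc, div_le_div_iff₀ (by linarith) hτ0]
            nlinarith
        _ = 2 ^ x * Q := by rw [Real.mul_rpow (by norm_num) (by positivity), hτQ]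
        _ ≤ 2 * Q := by
            gcongr
            simpa using Real.rpow_le_rpow_of_exponent_le one_le_two hx1
    have hk := h _ hk1 hkT
    rw [le_div_iff₀ hm'] at hk
    have h1 : (⌊τ⌋₊ : ℝ) * (g + e) ≤ 2 * Q := by
      rw [← hτe]
      calc (⌊τ⌋₊ : ℝ) * (g + e) ≤ ⌊τ⌋₊ * (2 * e) := by gcongr; linarith
        _ ≤ τ * (2 * e) := by gcongr
        _ = _ := by ring
    have h2 : B * (((T : ℝ) / ⌊τ⌋₊) ^ x / x) ≤ B * (2 * Q / x) := by gcongr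
    calc m * g ≤ 2 * Q + B * (2 * Q / x) := by linarith
      _ = _ := by ring

/-- When the gap `g` dominates the empirical risk `e`, the cut-off `k ≈ m / 4` lets the term
`k * (g + e) / m ≤ g / 2` be absorbed into the left-hand side. -/
theorem gap_le_of_empRisk_lt {B x e g : ℝ} {m T : ℕ} (hB : 0 ≤ B) (hT : 1 ≤ T) (hTm : T ≤ m)
    (hx : 0 < x) (hx1 : x ≤ 1) (hg : 0 < g) (hg1 : g ≤ 1) (heg : e < g)
    (hfull : g ≤ T * (g + e) / m)
    (h : ∀ k : ℕ, 1 ≤ k → k ≤ T → g ≤ (k * (g + e) + B * (((T : ℝ) / k) ^ x / x)) / m) :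
    g ≤ (9 + 16 * B) * ((1 + 1 / x) / m * ((T : ℝ) / m) ^ x) := by
  have hm' : (0 : ℝ) < m := by exact_mod_cast (by omega : 0 < m)
  have hT' : (1 : ℝ) ≤ T := by exact_mod_cast hT
  set P := ((T : ℝ) / m) ^ x with hP
  have hP0 : 0 < P := by positivity
  rw [le_div_iff₀ hm'] at hfull
  have hmT : m < 4 * T := by
    by_contra hcon
    have : (4 * T : ℝ) ≤ m := by exact_mod_cast not_lt.1 hcon
    nlinarith
  have hx' : 0 < 1 / x := by positivity
  have hBx : 0 ≤ B * (1 / x) := by positivity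
  rcases lt_or_ge m 4 with hm4 | hm4
  -- For `m < 4` there is no cut-off near `m / 4`, but then `g ≤ 1` suffices.
  · have hm3 : (m : ℝ) ≤ 3 := by exact_mod_cast (by omega : m ≤ 3)
    have hTm1 : (T : ℝ) / m ≤ 1 := (div_le_one hm').2 (by exact_mod_cast hTm)
    have hP3 : 1 / 3 ≤ P := by
      calc (1 : ℝ) / 3 ≤ T / m := by rw [div_le_div_iff₀ (by norm_num) hm']; linarith
        _ = ((T : ℝ) / m) ^ (1 : ℝ) := (Real.rpow_one _).symm
        _ ≤ P := Real.rpow_le_rpow_of_exponent_ge (by positivity) hTm1 hx1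
    calc g ≤ 1 := hg1
      _ = 9 * (1 / 3 * (1 / 3)) := by norm_num
      _ ≤ (9 + 16 * B) * ((1 + 1 / x) / m * P) := by
          gcongr
          · linarith
          · linarith
  · have hk4 : 4 * (m / 4) ≤ m := Nat.mul_div_le m 4
    have hk8 : m ≤ 8 * (m / 4) := by omega
    have hk0 : 1 ≤ m / 4 := by omega
    have hk := h (m / 4) hk0 (by omega)
    generalize m / 4 = k at hk4 hk8 hk hk0
    have hk4' : (4 * k : ℝ) ≤ m := by exact_mod_cast hk4
    have hk8' : (m : ℝ) ≤ 8 * k := by exact_mod_cast hk8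
    have hk0' : (1 : ℝ) ≤ k := by exact_mod_cast hk0
    rw [le_div_iff₀ hm'] at hk
    have hpow : ((T : ℝ) / k) ^ x ≤ 8 * P := by
      calc ((T : ℝ) / k) ^ x ≤ (8 * (T / m)) ^ x := by
            refine Real.rpow_le_rpow (by positivity) ?_ hx.le
            rw [← mul_div_assoc, div_le_div_iff₀ (by linarith) hm']
            nlinarith
        _ = 8 ^ x * P := by rw [Real.mul_rpow (by norm_num) (by positivity)]
        _ ≤ 8 * P := by
            gcongr
            simpa using Real.rpow_le_rpow_of_exponent_le (by norm_num : (1 : ℝ) ≤ 8) hx1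
    have h2 : B * (((T : ℝ) / k) ^ x / x) ≤ B * (8 * P / x) := by gcongr
    have h3 : (k : ℝ) * (g + e) ≤ k * (2 * g) := by gcongr; linarith
    have h4 : m * g ≤ 16 * (B * (1 / x)) * P := by
      have : B * (8 * P / x) = 8 * (B * (1 / x)) * P := by ring
      nlinarith
    calc g = m * g / m := by field_simp
      _ ≤ (9 + 16 * B) * (1 + 1 / x) * P / m := by
          refine div_le_div_of_nonneg_right (h4.trans ?_) hm'.le
          refine mul_le_mul_of_nonneg_right ?_ hP0.le
          nlinarith
      _ = _ := by ring

theorem gap_le_max {B x e g : ℝ} {m T : ℕ} (hB : 0 ≤ B) (hT : 1 ≤ T) (hTm : T ≤ m)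
    (hx : 0 < x) (hx1 : x ≤ 1) (he : 0 ≤ e) (he1 : e ≤ 1) (hg1 : g ≤ 1)
    (h : ∀ k : ℕ, k ≤ T →
      g ≤ (k * (g + e) + B * ∑ n ∈ Finset.Ico k T, 1 / ((n : ℝ) + 1)) / m) :
    g ≤ (9 + 16 * B) * ((1 + 1 / x) / m *
      max ((e * T) ^ (x / (1 + x))) (((T : ℝ) / m) ^ x)) := by
  have hm : 0 < m := by omega
  have hfull : g ≤ T * (g + e) / m := by simpa using h T le_rfl
  have hcut : ∀ k : ℕ, 1 ≤ k → k ≤ T →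
      g ≤ (k * (g + e) + B * (((T : ℝ) / k) ^ x / x)) / m := fun k hk hkT => by
    refine (h k hkT).trans ?_
    gcongr
    exact sum_Ico_inv_succ_le_rpow hk hkT hx
  rcases le_or_gt g 0 with hg | hg
  · exact hg.trans (by positivity)
  rcases le_or_gt g e with hge | heg
  · refine (gap_le_of_le_empRisk hB hT hm hx hx1 (hg.trans_le hge) he1 hge hfull hcut).trans ?_
    gcongr
    · norm_num
    · norm_num
    · exact le_max_left _ _
  · refine (gap_le_of_empRisk_lt hB hT hTm hx hx1 hg hg1 heg hfull hcut).trans ?_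
    gcongr
    exact le_max_right _ _

/-! ### Small empirical risk -/

theorem rpow_le_one_add {K q : ℝ} (hK : 0 ≤ K) (hq : 0 ≤ q) (hq1 : q ≤ 1) : K ^ q ≤ 1 + K := by
  calc K ^ q ≤ (1 + K) ^ q := Real.rpow_le_rpow hK (by linarith) hq
    _ ≤ (1 + K) ^ (1 : ℝ) := Real.rpow_le_rpow_of_exponent_le (by linarith) hq1
    _ = 1 + K := Real.rpow_one _

theorem max_le_of_empRisk_le_rpow {x e K : ℝ} {m T : ℕ} (hm : 0 < m) (hT : 0 < T) (hx : 0 < x)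
    (he : 0 ≤ e) (hK : 0 ≤ K) (h : e ≤ K * ((T : ℝ) ^ x / (m : ℝ) ^ (1 + x))) :
    max ((e * T) ^ (x / (1 + x))) (((T : ℝ) / m) ^ x) ≤ (1 + K) * ((T : ℝ) / m) ^ x := by
  have hm' : (0 : ℝ) < m := by exact_mod_cast hm
  have hT' : (0 : ℝ) < T := by exact_mod_cast hT
  have h1x : 0 < 1 + x := by linarith
  have hP : 0 < ((T : ℝ) / m) ^ x := by positivity
  refine max_le ?_ (by nlinarith)
  have hq1 : x / (1 + x) ≤ 1 := (div_le_one h1x).2 (by linarith)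
  calc (e * T) ^ (x / (1 + x))
      ≤ (K * ((T : ℝ) ^ x / (m : ℝ) ^ (1 + x)) * T) ^ (x / (1 + x)) := by gcongr
    _ = (K * ((T : ℝ) / m) ^ (1 + x)) ^ (x / (1 + x)) := by
        rw [Real.div_rpow hT'.le hm'.le, Real.rpow_add hT', Real.rpow_one]
        congr 1
        ring
    _ = K ^ (x / (1 + x)) * ((T : ℝ) / m) ^ x := by
        rw [Real.mul_rpow hK (by positivity), ← Real.rpow_mul (by positivity),
          mul_div_cancel₀ _ h1x.ne']
    _ ≤ (1 + K) * ((T : ℝ) / m) ^ x := by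
        gcongr
        exact rpow_le_one_add hK (by positivity) hq1

theorem max_le_of_empRisk_le_div {x e K : ℝ} {m T : ℕ} (hm : 0 < m) (hTm : T ≤ m)
    (hx : 0 < x) (he : 0 ≤ e) (hK : 0 ≤ K) (h : e ≤ K / m) :
    max ((e * T) ^ (x / (1 + x))) (((T : ℝ) / m) ^ x) ≤ 1 + K := by
  have hm' : (0 : ℝ) < m := by exact_mod_cast hm
  have hTm1 : (T : ℝ) / m ≤ 1 := (div_le_one hm').2 (by exact_mod_cast hTm)
  have h1x : 0 < 1 + x := by linarith
  have hq1 : x / (1 + x) ≤ 1 := (div_le_one h1x).2 (by linarith)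
  refine max_le ?_ ?_
  · have : e * T ≤ K := by
      calc e * T ≤ K / m * T := by gcongr
        _ = K * (T / m) := by ring
        _ ≤ K := mul_le_of_le_one_right hK hTm1
    calc (e * T) ^ (x / (1 + x)) ≤ K ^ (x / (1 + x)) := by gcongr
      _ ≤ 1 + K := rpow_le_one_add hK (by positivity) hq1
  · linarith [Real.rpow_le_one (by positivity) hTm1 hx.le]

/-- The step-size condition keeps the total expansion of SGD bounded in terms of `c` alone. -/
theorem mul_log_le_sqrt {c β ℓ : ℝ} (hc : 0 < c) (h : c * (4 * (2 * β * ℓ) ^ 2) ≤ 1) :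
    c * β * ℓ ≤ Real.sqrt c / 4 := by
  rw [le_div_iff₀ (by norm_num)]
  refine Real.le_sqrt_of_sq_le ?_
  nlinarith

end SGDStability

theorem mainTheorem3 :
    -- the constant `C` depends only on `c` and `L`
    ∀ c L : ℝ, 0 < c → 0 ≤ L → ∃ C : ℝ, 0 < C ∧
      ∀ (d : ℕ) (Z : Type*) [MeasurableSpace Z] (D : MeasureTheory.Measure Z)
        [MeasureTheory.IsProbabilityMeasure D]
        (f : SGDStability.Param d → Z → ℝ) (w₁ : SGDStability.Param d)
        (m T : ℕ) (β ρ σ κ p γ : ℝ),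
        1 ≤ T → T ≤ m → 0 < β → 0 ≤ ρ → 0 ≤ σ → 0 < κ → 0 ≤ p →
        (∀ w, Measurable (f w)) →
        (∀ w z, f w z ∈ Set.Icc (0 : ℝ) 1) →
        SGDStability.IsLipschitzLoss f L →
        SGDStability.IsSmoothLoss f β →
        SGDStability.HasLipschitzHessian f ρ →
        SGDStability.HasGradVariance D f c w₁ m T σ →
        -- step size; the second bound, `c ≤ 1 / (4 (2 β ln T)²)`, is void for `T = 1`
        c ≤ 1 / β →
        c * (4 * (2 * β * Real.log T) ^ 2) ≤ 1 →
        γ = SGDStability.sgdGamma D f c β ρ σ κ p w₁ T →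
        0 < γ →
        (SGDStability.expGap D f c w₁ m T ≤
            C * ((1 + 1 / (c * γ)) / m *
              max ((SGDStability.expEmpRisk D f c w₁ m T * T) ^ (c * γ / (1 + c * γ)))
                (((T : ℝ) / m) ^ (c * γ)))) ∧
        (∀ K : ℝ, 0 ≤ K →
          SGDStability.expEmpRisk D f c w₁ m T ≤
            K * ((T : ℝ) ^ (c * γ) / (m : ℝ) ^ (1 + c * γ)) →
          SGDStability.expGap D f c w₁ m T ≤
            C * (1 + K) * (1 + 1 / (c * γ)) * ((T : ℝ) ^ (c * γ) / (m : ℝ) ^ (1 + c * γ))) ∧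
        (∀ K : ℝ, 0 ≤ K →
          SGDStability.expEmpRisk D f c w₁ m T ≤ K / m →
          SGDStability.expGap D f c w₁ m T ≤ C * (1 + K) * (1 + 1 / (c * γ)) / m) := by
  intro c L hc hL
  refine ⟨9 + 16 * (2 * c * L ^ 2 * Real.exp (Real.sqrt c / 4)), by positivity, ?_⟩
  intro d Z _ D _ f w₁ m T β ρ σ κ p γ hT hTm hβ _ _ _ _ hmeas h01 hf hs _ _ hcβ hstep hγ hγ0
  have hm : 0 < m := by omega
  have hm' : (0 : ℝ) < m := by exact_mod_cast hm
  have hγβ : γ ≤ β := hγ ▸ min_le_left _ _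
  have hx : 0 < c * γ := mul_pos hc hγ0
  have hx1 : c * γ ≤ 1 :=
    (mul_le_mul_of_nonneg_left hγβ hc.le).trans ((le_div_iff₀ hβ).1 hcβ)
  have he := SGDStability.expEmpRisk_mem_Icc (D := D) (c := c) (w₁ := w₁) (m := m) (T := T)
    hmeas h01 hs
  have hg1 := SGDStability.expGap_le_one (D := D) (c := c) (w₁ := w₁) (m := m) (T := T)
    hmeas h01 hs
  have hexp := SGDStability.mul_log_le_sqrt hc hstep
  have hmain := SGDStability.gap_le_max (B := 2 * c * L ^ 2 * Real.exp (Real.sqrt c / 4))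
    (by positivity) hT hTm hx hx1 he.1 he.2 hg1 fun k hk =>
      (SGDStability.expGap_le (D := D) (w₁ := w₁) hc.le hL hβ.le hmeas h01 hf hs hT hTm hk).trans
        (by gcongr)
  have hC : 0 < 9 + 16 * (2 * c * L ^ 2 * Real.exp (Real.sqrt c / 4)) := by positivity
  generalize SGDStability.expGap D f c w₁ m T = g at hmain ⊢
  generalize SGDStability.expEmpRisk D f c w₁ m T = e at he hmain ⊢
  generalize 9 + 16 * (2 * c * L ^ 2 * Real.exp (Real.sqrt c / 4)) = C at hC hmain ⊢
  generalize c * γ = x at hx hmain ⊢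
  have hmax : ∀ b, max ((e * T) ^ (x / (1 + x))) (((T : ℝ) / m) ^ x) ≤ b →
      g ≤ C * ((1 + 1 / x) / m * b) := fun b hb => hmain.trans (by gcongr)
  refine ⟨hmain, fun K hK h => ?_, fun K hK h => ?_⟩
  · refine (hmax _ (SGDStability.max_le_of_empRisk_le_rpow hm hT hx he.1 hK h)).trans
      (le_of_eq ?_)
    rw [Real.div_rpow (Nat.cast_nonneg _) hm'.le, Real.rpow_add hm', Real.rpow_one]
    field_simp
  · refine (hmax _ (SGDStability.max_le_of_empRisk_le_div hm hTm hx he.1 hK h)).trans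
      (le_of_eq ?_)
    ring
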